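/- Let $\mathcal{A}$ and $\mathcal{B}$ be abelian categories, each with enough projective objects and enough injective objects, and let $T:\mathcal{A}\to\mathcal{B}$ be an exact (additive) functor. Let $(\mathcal{B}\downarrow T)$ be the comma category: its objects are triples $(A,B,\varphi)$ with $A\in\mathcal{A}$, $B\in\mathcal{B}$ and $\varphi:B\to TA$ a morphism of $\mathcal{B}$, and a morphism $(A,B,\varphi)\to(A',B',\varphi')$ is a pair $(\alpha:A\to A',\ \beta:B\to B')$ with $\varphi'\beta=T(\alpha)\varphi$. Let $\mathbf{h}:\mathcal{A}\times\mathcal{B}\to(\mathcal{B}\downarrow T)$ be the functor that sends $(A,B)$ to $(A,\ B\oplus TA,\ \mathrm{pr}_{TA})$ and $(\alpha,\beta)$ to $(\alpha,\ \beta\oplus T\alpha)$. Let $\langle\mathbf{h}(\mathcal{A},\mathcal{B})\rangle$ be the full subcategory of $(\mathcal{B}\downarrow T)$ whose class of objects is the smallest class that contains all objects isomorphic to some $\mathbf{h}(A,B)$ and is closed under extensions; its conflations are the sequences in it that are short exact in $(\mathcal{B}\downarrow T)$. Then $\langle\mathbf{h}(\mathcal{A},\mathcal{B})\rangle$ with these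 conflations is an exact category in the sense of Quillen, and it is a Frobenius category if and only if $\mathcal{A}$ and $\mathcal{B}$ (with all short exact sequences as conflations) are Frobenius categories and $T$ sends injective objects of $\mathcal{A}$ to injective objects of $\mathcal{B}$. Here a Frobenius category is an exact category with enough projective and enough injective objects (relative to its conflations) in which the projective objects and the injective objects coincide. -/

import Mathlib

open CategoryTheory CategoryTheory.Limits

universe v v₁ v₂ u u₁ u₂

namespace FrobeniusComma

/-! ### Exact categories in the sense of Quillen and Frobenius categories -/

section ExactCategories

variable {C : Type u} [Category.{v} C] [Preadditive C] (E : ObjectProperty (ShortComplex C))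

/-- A morphism `i` is an inflation (admissible monomorphism) for a class `E` of short complexes
if it is the first morphism of a member of `E`. -/
def IsInflation {X Y : C} (i : X ⟶ Y) : Prop :=
  ∃ (Z : C) (p : Y ⟶ Z) (w : i ≫ p = 0), E (ShortComplex.mk i p w)

/-- A morphism `p` is a deflation (admissible epimorphism) for a class `E` of short complexes
if it is the second morphism of a member of `E`. -/
def IsDeflation {Y Z : C} (p : Y ⟶ Z) : Prop :=
  ∃ (X : C) (i : X ⟶ Y) (w : i ≫ p = 0), E (ShortComplex.mk i p w)

/-- The class `E` of short complexes (the conflations) is an exact structure, in the sense of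
Quillen, on the category `C`, which is required to be additive. -/
structure IsExactStructure : Prop where
  /-- `C` is an additive category. -/
  hasFiniteBiproducts : HasFiniteBiproducts C
  /-- The first morphism of a conflation is a kernel of the second one. -/
  kernel : ∀ S : ShortComplex C, E S → Nonempty (IsLimit (KernelFork.ofι S.f S.zero))
  /-- The second morphism of a conflation is a cokernel of the first one. -/
  cokernel : ∀ S : ShortComplex C, E S → Nonempty (IsColimit (CokernelCofork.ofπ S.g S.zero))
  /-- Conflations are closed under isomorphisms. -/
  of_iso : ∀ S S' : ShortComplex C, Nonempty (S ≅ S') → E S → E S'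
  id_inflation : ∀ X : C, IsInflation E (𝟙 X)
  id_deflation : ∀ X : C, IsDeflation E (𝟙 X)
  comp_inflation : ∀ {X Y Z : C} (i : X ⟶ Y) (j : Y ⟶ Z),
    IsInflation E i → IsInflation E j → IsInflation E (i ≫ j)
  comp_deflation : ∀ {X Y Z : C} (p : X ⟶ Y) (q : Y ⟶ Z),
    IsDeflation E p → IsDeflation E q → IsDeflation E (p ≫ q)
  /-- The pushout of an inflation along any morphism exists and yields an inflation. -/
  pushout : ∀ {X Y X' : C} (i : X ⟶ Y) (f : X ⟶ X'), IsInflation E i →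
    ∃ (Y' : C) (f' : Y ⟶ Y') (i' : X' ⟶ Y'), IsPushout i f f' i' ∧ IsInflation E i'
  /-- The pullback of a deflation along any morphism exists and yields a deflation. -/
  pullback : ∀ {Y Z Z' : C} (p : Y ⟶ Z) (f : Z' ⟶ Z), IsDeflation E p →
    ∃ (Y' : C) (f' : Y' ⟶ Y) (p' : Y' ⟶ Z'), IsPullback f' p' p f ∧ IsDeflation E p'

/-- `P` is projective relative to `E`: morphisms out of `P` lift along deflations. -/
def IsRelProjective (P : C) : Prop :=
  ∀ {Y Z : C} (p : Y ⟶ Z), IsDeflation E p → ∀ f : P ⟶ Z, ∃ g : P ⟶ Y, g ≫ p = f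

/-- `I` is injective relative to `E`: morphisms into `I` extend along inflations. -/
def IsRelInjective (I : C) : Prop :=
  ∀ {X Y : C} (i : X ⟶ Y), IsInflation E i → ∀ f : X ⟶ I, ∃ g : Y ⟶ I, i ≫ g = f

/-- The category `C` with the class of conflations `E` is a Frobenius category: an exact category
with enough projectives and enough injectives, whose projective objects and injective objects
coincide. -/
structure IsFrobenius : Prop where
  isExactStructure : IsExactStructure E
  enoughProjectives : ∀ X : C, ∃ (P : C) (p : P ⟶ X), IsRelProjective E P ∧ IsDeflation E p
  enoughInjectives : ∀ X : C, ∃ (I : C) (i : X ⟶ I), IsRelInjective E I ∧ IsInflation E i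
  projective_iff_injective : ∀ X : C, IsRelProjective E X ↔ IsRelInjective E X

variable (C) in
/-- The class of all short exact sequences; it is used for abelian categories `C`. -/
def shortExactSequences : ObjectProperty (ShortComplex C) :=
  fun S => S.ShortExact

/-- The smallest class of objects that contains `P` and is closed under extensions. -/
inductive extensionClosure (P : ObjectProperty C) : ObjectProperty C
  | of_mem (X : C) (hX : P X) : extensionClosure P X
  | of_shortExact (S : ShortComplex C) (hS : S.ShortExact) (h₁ : extensionClosure P S.X₁)
      (h₃ : extensionClosure P S.X₃) : extensionClosure P S.X₂

/-- The conflations of a full subcategory: the sequences in it that are short exact in the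
ambient category. -/
def inducedConflations (P : ObjectProperty C) : ObjectProperty (ShortComplex P.FullSubcategory) :=
  fun S => (ShortComplex.mk S.f.hom S.g.hom
    (by rw [← ObjectProperty.FullSubcategory.comp_hom, S.zero]; rfl)).ShortExact

lemma le_extensionClosure (P : ObjectProperty C) : P ≤ extensionClosure P :=
  fun X hX => .of_mem X hX

instance (P : ObjectProperty C) : (extensionClosure P).IsClosedUnderExtensions where
  prop_X₂_of_shortExact {S} hS h₁ h₃ := .of_shortExact S hS h₁ h₃

lemma extensionClosure_le (P Q : ObjectProperty C) [Q.IsClosedUnderExtensions] (h : P ≤ Q) :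
    extensionClosure P ≤ Q := by
  intro X hX
  induction hX with
  | of_mem X hX => exact h X hX
  | of_shortExact S hS _ _ h₁ h₃ => exact Q.prop_X₂_of_shortExact hS h₁ h₃

end ExactCategories

/-! ### The comma category `(ℬ ↓ T)` and the extension closure `⟨h(𝒜, ℬ)⟩` -/

section CommaCategories

variable {𝒜 : Type u₁} [Category.{v₁} 𝒜] [Abelian 𝒜]
  {ℬ : Type u₂} [Category.{v₂} ℬ] [Abelian ℬ] (T : 𝒜 ⥤ ℬ)

/-- The comma category `(ℬ ↓ T)`: its objects are the triples of `A : 𝒜` (field `right`),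
`B : ℬ` (field `left`) and a morphism `B ⟶ T.obj A` (field `hom`). -/
abbrev CommaCat := Comma (𝟭 ℬ) T

/-- The functor `h : 𝒜 × ℬ ⥤ (ℬ ↓ T)` that sends `(A, B)` to the projection
`B ⊞ T.obj A ⟶ T.obj A`. -/
noncomputable def hFunctor : 𝒜 × ℬ ⥤ CommaCat T where
  obj X :=
    { left := X.2 ⊞ T.obj X.1
      right := X.1
      hom := (biprod.snd : X.2 ⊞ T.obj X.1 ⟶ T.obj X.1) }
  map f :=
    { left := biprod.map f.2 (T.map f.1)
      right := f.1
      w := by simp }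
  map_id X := by
    apply CommaMorphism.ext
    · apply biprod.hom_ext <;> simp
    · simp
  map_comp f g := by
    apply CommaMorphism.ext
    · apply biprod.hom_ext <;> simp
    · simp

/-- The class `⟨h(𝒜, ℬ)⟩` of objects of `(ℬ ↓ T)`: the extension closure of the image of `h`. -/
def hClosure [T.Additive] : ObjectProperty (CommaCat T) :=
  extensionClosure (hFunctor T).essImage

/-- The full subcategory `⟨h(𝒜, ℬ)⟩` of `(ℬ ↓ T)`. -/
abbrev HCat [T.Additive] := (hClosure T).FullSubcategory

/-- The conflations of `⟨h(𝒜, ℬ)⟩`: the sequences in it that are short exact in `(ℬ ↓ T)`. -/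
def hConflations [T.Additive] : ObjectProperty (ShortComplex (HCat T)) :=
  inducedConflations (hClosure T)

end CommaCategories

end FrobeniusComma

/-! The extension closure consists of the objects `φ : B ⟶ T A` with `φ` epi (`hClosure_eq`): this
condition is stable under extensions, and an epi `φ` is an extension of the identity of `T A` by
`ker φ ⟶ 0`, both in the image of `h`. An extension-closed subcategory of the abelian comma category
is exact. The relative projectives are the objects with `A` and `B` both projective
(`isRelProjective_hConflations_iff`); the relative injectives are the retracts of objects `h(I, J)`
with `I`, `J` injective (`isRelInjective_hObj`, `IsRelInjective.exists_retract_hObj`). If `𝒜`, `ℬ`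
are Frobenius and `T` preserves injectives, the two classes agree, because `T A` is projective for
projective `A`, so `φ` splits and the object is a retract of `h(A, B)`. Conversely, the objects
`h(I, 0)`, `h(0, J)` and projective covers with prescribed `A`-component transfer the coincidence to
`𝒜` and `ℬ`. -/

namespace FrobeniusComma

/-! ### Abelian comma categories. -/

section Comma

variable {A : Type u₁} [Category.{v₁} A] {B : Type u₂} [Category.{v₂} B]
  {D : Type u} [Category.{v} D] {L : A ⥤ D} {R : B ⥤ D}

instance preservesLimitsOfShape_fst {J : Type*} [Category J] [HasLimitsOfShape J A]
    [HasLimitsOfShape J B] [PreservesLimitsOfShape J R] :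
    PreservesLimitsOfShape J (Comma.fst L R) where
  preservesLimit :=
    preservesLimit_of_preserves_limit_cone
      (Comma.coneOfPreservesIsLimit _ (limit.isLimit _) (limit.isLimit _)) (limit.isLimit _)

instance preservesLimitsOfShape_snd {J : Type*} [Category J] [HasLimitsOfShape J A]
    [HasLimitsOfShape J B] [PreservesLimitsOfShape J R] :
    PreservesLimitsOfShape J (Comma.snd L R) where
  preservesLimit :=
    preservesLimit_of_preserves_limit_cone
      (Comma.coneOfPreservesIsLimit _ (limit.isLimit _) (limit.isLimit _)) (limit.isLimit _)

variable [Abelian A] [Abelian B] [Abelian D] [L.Additive] [R.Additive]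
  [PreservesFiniteColimits L] [PreservesFiniteLimits R]

instance : PreservesFiniteLimits (Comma.fst L R) where
  preservesFiniteLimits _ := inferInstance

instance : PreservesFiniteLimits (Comma.snd L R) where
  preservesFiniteLimits _ := inferInstance

instance : PreservesFiniteColimits (Comma.fst L R) where
  preservesFiniteColimits _ := inferInstance

instance : PreservesFiniteColimits (Comma.snd L R) where
  preservesFiniteColimits _ := inferInstance

/-- An exact functor commutes with the coimage-image comparison, which is invertible in the abelian
target. It is applied to the two projections of the comma category, which jointly detect
isomorphisms. -/
lemma isIso_coimageImageComparison_map {C C' : Type*} [Category C] [Category C'] [Preadditive C]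
    [HasFiniteLimits C] [HasFiniteColimits C] [Abelian C']
    (F : C ⥤ C') [F.Additive] [PreservesFiniteLimits F] [PreservesFiniteColimits F]
    {X Y : C} (f : X ⟶ Y) : IsIso (F.map (Abelian.coimageImageComparison f)) := by
  have h := (MorphismProperty.isomorphisms C').arrow_mk_iso_iff
    (Abelian.PreservesCoimageImageComparison.iso F f)
  simp only [MorphismProperty.isomorphisms.iff] at h
  exact h.2 inferInstance

instance {X Y : Comma L R} (f : X ⟶ Y) : IsIso (Abelian.coimageImageComparison f) := by
  set c := Abelian.coimageImageComparison f
  have : IsIso c.left := isIso_coimageImageComparison_map (Comma.fst L R) f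
  have : IsIso c.right := isIso_coimageImageComparison_map (Comma.snd L R) f
  have := (Comma.isoMk (asIso c.left) (asIso c.right) c.w).isIso_hom
  exact this

/-- The comma category of a right exact functor and a left exact functor is abelian. -/
noncomputable instance abelianComma : Abelian (Comma L R) :=
  Abelian.ofCoimageImageComparisonIsIso

lemma mono_comma_iff {X Y : Comma L R} (f : X ⟶ Y) : Mono f ↔ Mono f.left ∧ Mono f.right := by
  refine ⟨fun _ => ⟨inferInstanceAs (Mono ((Comma.fst L R).map f)),
    inferInstanceAs (Mono ((Comma.snd L R).map f))⟩, fun ⟨_, _⟩ => ⟨fun g h e => ?_⟩⟩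
  ext
  · exact (cancel_mono f.left).1 (congr_arg CommaMorphism.left e)
  · exact (cancel_mono f.right).1 (congr_arg CommaMorphism.right e)

lemma epi_comma_iff {X Y : Comma L R} (f : X ⟶ Y) : Epi f ↔ Epi f.left ∧ Epi f.right := by
  refine ⟨fun _ => ⟨inferInstanceAs (Epi ((Comma.fst L R).map f)),
    inferInstanceAs (Epi ((Comma.snd L R).map f))⟩, fun ⟨_, _⟩ => ⟨fun g h e => ?_⟩⟩
  ext
  · exact (cancel_epi f.left).1 (congr_arg CommaMorphism.left e)
  · exact (cancel_epi f.right).1 (congr_arg CommaMorphism.right e)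

end Comma


/-! ### Abelian categories as exact categories. -/

section General
variable {C : Type u} [Category.{v} C] [Abelian C]

lemma isInflation_shortExactSequences_iff {X Y : C} (i : X ⟶ Y) :
    IsInflation (shortExactSequences C) i ↔ Mono i :=
  ⟨fun ⟨_, _, _, h⟩ => h.mono_f, fun _ => ⟨_, cokernel.π i, cokernel.condition i,
    { exact := ShortComplex.exact_cokernel i }⟩⟩

lemma isDeflation_shortExactSequences_iff {X Y : C} (p : X ⟶ Y) :
    IsDeflation (shortExactSequences C) p ↔ Epi p :=
  ⟨fun ⟨_, _, _, h⟩ => h.epi_g, fun _ => ⟨_, kernel.ι p, kernel.condition p,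
    { exact := ShortComplex.exact_kernel p }⟩⟩

lemma isExactStructure_shortExactSequences : IsExactStructure (shortExactSequences C) where
  hasFiniteBiproducts := Abelian.hasFiniteBiproducts
  kernel S hS := ⟨hS.fIsKernel⟩
  cokernel S hS := ⟨hS.gIsCokernel⟩
  of_iso S S' e h := ShortComplex.shortExact_of_iso e.some h
  id_inflation X := by rw [isInflation_shortExactSequences_iff]; infer_instance
  id_deflation X := by rw [isDeflation_shortExactSequences_iff]; infer_instance
  comp_inflation i j := by
    simp only [isInflation_shortExactSequences_iff]; exact fun _ _ => mono_comp i j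
  comp_deflation i j := by
    simp only [isDeflation_shortExactSequences_iff]; exact fun _ _ => epi_comp i j
  pushout i f hi := by
    rw [isInflation_shortExactSequences_iff] at hi
    exact ⟨_, _, _, IsPushout.of_hasPushout i f,
      (isInflation_shortExactSequences_iff _).2 inferInstance⟩
  pullback p f hp := by
    rw [isDeflation_shortExactSequences_iff] at hp
    exact ⟨_, _, _, (IsPullback.of_hasPullback f p).flip,
      (isDeflation_shortExactSequences_iff _).2 inferInstance⟩

lemma isRelProjective_shortExactSequences_iff (P : C) :
    IsRelProjective (shortExactSequences C) P ↔ Projective P := by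
  simp only [IsRelProjective, isDeflation_shortExactSequences_iff]
  exact ⟨fun h => ⟨fun f p _ => h p inferInstance f⟩,
    fun _ Y Z p _ f => ⟨Projective.factorThru f p, by simp⟩⟩

lemma isRelInjective_shortExactSequences_iff (I : C) :
    IsRelInjective (shortExactSequences C) I ↔ Injective I := by
  simp only [IsRelInjective, isInflation_shortExactSequences_iff]
  exact ⟨fun h => ⟨fun f p _ => h p inferInstance f⟩,
    fun _ Y Z p _ f => ⟨Injective.factorThru f p, by simp⟩⟩

lemma isFrobenius_shortExactSequences_iff [EnoughProjectives C] [EnoughInjectives C] :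
    IsFrobenius (shortExactSequences C) ↔ ∀ X : C, Projective X ↔ Injective X := by
  constructor
  · intro h X
    rw [← isRelProjective_shortExactSequences_iff, ← isRelInjective_shortExactSequences_iff]
    exact h.projective_iff_injective X
  · intro h
    refine ⟨isExactStructure_shortExactSequences, fun X => ⟨_, Projective.π X, ?_, ?_⟩,
      fun X => ⟨_, Injective.ι X, ?_, ?_⟩, fun X => ?_⟩
    · rw [isRelProjective_shortExactSequences_iff]; infer_instance
    · rw [isDeflation_shortExactSequences_iff]; infer_instance
    · rw [isRelInjective_shortExactSequences_iff]; infer_instance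
    · rw [isInflation_shortExactSequences_iff]; infer_instance
    · rw [isRelProjective_shortExactSequences_iff, isRelInjective_shortExactSequences_iff, h]
end General

/-! ### Extension-closed subcategories of abelian categories. -/

section Extensions
variable {C : Type u} [Category.{v} C] [Abelian C] 

/-- Tail of the six-term kernel-cokernel sequence of a composite, with `ker g = 0`. It makes
inflations closed under composition. -/
lemma shortExact_cokernel_comp {X Y Z : C} (f : X ⟶ Y) (g : Y ⟶ Z) [Mono g] :
    (ShortComplex.mk (cokernel.map f (f ≫ g) (𝟙 _) g (by simp))
      (cokernel.map (f ≫ g) g f (𝟙 _) (by simp)) (by ext; simp)).ShortExact where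
  exact := (kernelCokernelCompSequence_exact f g).exact 3
  mono_f := ((kernelCokernelCompSequence_exact f g).exact 2).mono_g
    ((isZero_kernel_of_mono g).eq_of_src _ _)
  epi_g := by dsimp; infer_instance

lemma shortExact_kernel_comp {X Y Z : C} (f : X ⟶ Y) (g : Y ⟶ Z) [Epi f] :
    (ShortComplex.mk (kernel.map f (f ≫ g) (𝟙 _) g (by simp))
      (kernel.map (f ≫ g) g f (𝟙 _) (by simp)) (by ext; simp)).ShortExact where
  exact := (kernelCokernelCompSequence_exact f g).exact 0
  mono_f := by dsimp; infer_instance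
  epi_g := ((kernelCokernelCompSequence_exact f g).exact 1).epi_f
    ((isZero_cokernel_of_epi f).eq_of_tgt _ _)

variable (P : ObjectProperty C) [P.IsClosedUnderIsomorphisms]

lemma isInflation_inducedConflations_iff {X Y : P.FullSubcategory} (i : X ⟶ Y) :
    IsInflation (inducedConflations P) i ↔ Mono i.hom ∧ P (cokernel i.hom) := by
  constructor
  · rintro ⟨Z, p, w, h⟩
    exact ⟨h.mono_f, P.prop_of_iso
      ((cokernelIsCokernel i.hom).coconePointUniqueUpToIso h.gIsCokernel).symm Z.property⟩
  · rintro ⟨_, h⟩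
    exact ⟨⟨_, h⟩, P.homMk (cokernel.π i.hom), by ext; simp,
      { exact := ShortComplex.exact_cokernel i.hom
        mono_f := by assumption
        epi_g := (inferInstance : Epi (cokernel.π i.hom)) }⟩

lemma isDeflation_inducedConflations_iff {X Y : P.FullSubcategory} (p : X ⟶ Y) :
    IsDeflation (inducedConflations P) p ↔ Epi p.hom ∧ P (kernel p.hom) := by
  constructor
  · rintro ⟨Z, i, w, h⟩
    exact ⟨h.epi_g, P.prop_of_iso
      ((kernelIsKernel p.hom).conePointUniqueUpToIso h.fIsKernel).symm Z.property⟩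
  · rintro ⟨_, h⟩
    exact ⟨⟨_, h⟩, P.homMk (kernel.ι p.hom), by ext; simp,
      { exact := ShortComplex.exact_kernel p.hom
        mono_f := (inferInstance : Mono (kernel.ι p.hom))
        epi_g := by assumption }⟩

variable [P.IsClosedUnderExtensions] [P.ContainsZero]

lemma isClosedUnderFiniteProducts_of_extensions : P.IsClosedUnderFiniteProducts := by
  have : P.IsClosedUnderBinaryProducts := .mk' (by
    rintro _ ⟨F, hF⟩
    exact P.prop_of_iso ((biprod.isoProd _ _).trans (HasLimit.isoOfNatIso (diagramIsoPair F)).symm)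
      (P.prop_biprod (hF ⟨.left⟩) (hF ⟨.right⟩)))
  exact .mk'

/-- An extension closed full subcategory of an abelian category is an exact category. -/
lemma isExactStructure_inducedConflations : IsExactStructure (inducedConflations P) where
  hasFiniteBiproducts := by
    have := isClosedUnderFiniteProducts_of_extensions P
    exact .of_hasFiniteProducts
  kernel S hS := by
    have := hS.mono_f
    have : Mono S.f := P.ι.mono_of_mono_map hS.mono_f
    exact ⟨KernelFork.IsLimit.ofι' _ _ fun k hk =>
      ⟨P.homMk (hS.exact.lift k.hom congr(($hk).hom)), by
        ext; exact hS.exact.lift_f _ _⟩⟩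
  cokernel S hS := by
    have := hS.epi_g
    have : Epi S.g := P.ι.epi_of_epi_map hS.epi_g
    exact ⟨CokernelCofork.IsColimit.ofπ' _ _ fun k hk =>
      ⟨P.homMk (hS.exact.desc k.hom congr(($hk).hom)), by
        ext; exact hS.exact.g_desc _ _⟩⟩
  of_iso S S' e h := ShortComplex.shortExact_of_iso (P.ι.mapShortComplex.mapIso e.some) h
  id_inflation X := by
    rw [isInflation_inducedConflations_iff]
    exact ⟨inferInstanceAs (Mono (𝟙 X.obj)), P.prop_of_isZero (isZero_cokernel_of_epi (𝟙 X.obj))⟩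
  id_deflation X := by
    rw [isDeflation_inducedConflations_iff]
    exact ⟨inferInstanceAs (Epi (𝟙 X.obj)), P.prop_of_isZero (isZero_kernel_of_mono (𝟙 X.obj))⟩
  comp_inflation i j := by
    simp only [isInflation_inducedConflations_iff]
    rintro ⟨_, hi⟩ ⟨_, hj⟩
    exact ⟨mono_comp i.hom j.hom,
      P.prop_X₂_of_shortExact (shortExact_cokernel_comp i.hom j.hom) hi hj⟩
  comp_deflation i j := by
    simp only [isDeflation_inducedConflations_iff]
    rintro ⟨_, hi⟩ ⟨_, hj⟩
    exact ⟨epi_comp i.hom j.hom,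
      P.prop_X₂_of_shortExact (shortExact_kernel_comp i.hom j.hom) hi hj⟩
  pushout {X Y X'} i f hi := by
    simp only [isInflation_inducedConflations_iff] at hi ⊢
    obtain ⟨_, hi⟩ := hi
    have sq := IsPushout.of_hasPushout i.hom f.hom
    -- Parallel maps of a pushout square have isomorphic cokernels, so the pushout is an extension
    -- of `coker i` by `X'`.
    have := isIso_cokernel_map_of_isPushout sq
    have hc := P.prop_of_iso (asIso (cokernel.map _ _ _ _ sq.w)) hi
    have hY : P (pushout i.hom f.hom) := P.prop_X₂_of_shortExact
      (S := ShortComplex.mk _ _ (cokernel.condition (pushout.inr i.hom f.hom)))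
      { exact := ShortComplex.exact_cokernel _ } X'.property hc
    exact ⟨⟨_, hY⟩, P.homMk (pushout.inl i.hom f.hom), P.homMk (pushout.inr i.hom f.hom),
      IsPushout.of_map P.ι (by ext; exact sq.w) sq,
      inferInstanceAs (Mono (pushout.inr i.hom f.hom)), hc⟩
  pullback {Y Z Z'} p f hp := by
    simp only [isDeflation_inducedConflations_iff] at hp ⊢
    obtain ⟨_, hp⟩ := hp
    have sq := (IsPullback.of_hasPullback p.hom f.hom)
    have := isIso_kernel_map_of_isPullback sq.flip
    have hc := P.prop_of_iso (asIso (kernel.map _ _ _ _ sq.flip.w)).symm hp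
    have hY : P (pullback p.hom f.hom) := P.prop_X₂_of_shortExact
      (S := ShortComplex.mk _ _ (kernel.condition (pullback.snd p.hom f.hom)))
      { exact := ShortComplex.exact_kernel _ } hc Z'.property
    exact ⟨⟨_, hY⟩, P.homMk (pullback.fst p.hom f.hom), P.homMk (pullback.snd p.hom f.hom),
      IsPullback.of_map P.ι (by ext; exact sq.w) sq,
      inferInstanceAs (Epi (pullback.snd p.hom f.hom)), hc⟩

end Extensions

/-! ### Relative injectives, projectives and retracts. -/

section Relative

variable {C : Type u} [Category.{v} C] [Preadditive C] {E : ObjectProperty (ShortComplex C)}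

lemma IsRelInjective.of_retract {X Y : C} (hY : IsRelInjective E Y) (r : Retract X Y) :
    IsRelInjective E X := fun i hi f => by
  obtain ⟨g, hg⟩ := hY i hi (f ≫ r.i)
  exact ⟨g ≫ r.r, by simp [reassoc_of% hg]⟩

lemma IsRelProjective.exists_retract {X Y : C} (hX : IsRelProjective E X) (p : Y ⟶ X)
    (hp : IsDeflation E p) : Nonempty (Retract X Y) := by
  obtain ⟨s, hs⟩ := hX p hp (𝟙 X)
  exact ⟨⟨s, p, hs⟩⟩

lemma IsRelInjective.exists_retract {X Y : C} (hX : IsRelInjective E X) (i : X ⟶ Y)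
    (hi : IsInflation E i) : Nonempty (Retract X Y) := by
  obtain ⟨s, hs⟩ := hX i hi (𝟙 X)
  exact ⟨⟨i, s, hs⟩⟩

end Relative

section StructureMap

variable {𝒜 : Type u₁} [Category.{v₁} 𝒜] {ℬ : Type u₂} [Category.{v₂} ℬ] {T : 𝒜 ⥤ ℬ}

/-- The structure morphism `B ⟶ T A` of an object of the comma category. -/
def structureMap (X : Comma (𝟭 ℬ) T) : X.left ⟶ T.obj X.right := X.hom

lemma structureMap_naturality {X Y : Comma (𝟭 ℬ) T} (f : X ⟶ Y) :
    f.left ≫ structureMap Y = structureMap X ≫ T.map f.right := f.w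

/-- Constructor for morphisms of the comma category, in terms of `structureMap`. -/
def commaHom {X Y : Comma (𝟭 ℬ) T} (l : X.left ⟶ Y.left) (r : X.right ⟶ Y.right)
    (w : l ≫ structureMap Y = structureMap X ≫ T.map r) : X ⟶ Y where
  left := l
  right := r
  w := w

end StructureMap

/-! ### The extension closure: objects, conflations, projectives and injectives. -/

section HClosure

open ZeroObject

variable {𝒜 : Type u₁} [Category.{v₁} 𝒜] [Abelian 𝒜] {ℬ : Type u₂} [Category.{v₂} ℬ] [Abelian ℬ]

lemma essImage_of_isZero_right {T : 𝒜 ⥤ ℬ} [T.Additive] (X : CommaCat T) (h : IsZero X.right) :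
    (hFunctor T).essImage X :=
  ⟨(X.right, X.left), ⟨Comma.isoMk (isoBiprodZero (T.map_isZero h)).symm (Iso.refl _)
    ((T.map_isZero h).eq_of_tgt _ _)⟩⟩

omit [Abelian 𝒜] in
lemma essImage_of_isIso_structureMap {T : 𝒜 ⥤ ℬ} (X : CommaCat T) [IsIso (structureMap X)] :
    (hFunctor T).essImage X :=
  ⟨(X.right, 0), ⟨Comma.isoMk
    ((isoZeroBiprod (isZero_zero _)).symm ≪≫ (asIso (structureMap X)).symm) (Iso.refl _) (by
      change ((biprod.snd : (0 : ℬ) ⊞ T.obj X.right ⟶ _) ≫ inv (structureMap X)) ≫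
        structureMap X = (biprod.snd : (0 : ℬ) ⊞ T.obj X.right ⟶ _) ≫ T.map (𝟙 _)
      simp)⟩⟩

variable (T : 𝒜 ⥤ ℬ) [T.Additive] [PreservesFiniteLimits T] [PreservesFiniteColimits T]

/-- The class of objects of the comma category whose structure morphism is an epimorphism. -/
def epiStructureMap : ObjectProperty (CommaCat T) := fun X => Epi (structureMap X)

variable {T} in
lemma epi_structureMap_of_epi {X Y : CommaCat T} (f : X ⟶ Y) [Epi f.right]
    [Epi (structureMap X)] : Epi (structureMap Y) :=
  have : Epi (f.left ≫ structureMap Y) := by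
    rw [structureMap_naturality]
    exact epi_comp _ _
  epi_of_epi f.left _

instance : (epiStructureMap T).IsClosedUnderIsomorphisms where
  of_iso e (_ : Epi _) :=
    have := ((epi_comma_iff e.hom).1 inferInstance).2
    epi_structureMap_of_epi e.hom

instance : (epiStructureMap T).ContainsZero where
  exists_zero := by
    have : HasZeroObject (CommaCat T) := inferInstance
    refine ⟨0, isZero_zero _, ⟨fun g h _ => IsZero.eq_of_src ?_ _ _⟩⟩
    exact (Comma.snd (𝟭 ℬ) T ⋙ T).map_isZero (isZero_zero _)

instance : (epiStructureMap T).IsClosedUnderExtensions where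
  prop_X₂_of_shortExact {S} hS h₁ h₃ := by
    have := hS.mono_f
    have := hS.epi_g
    let φ : S.map (Comma.fst (𝟭 ℬ) T) ⟶ S.map (Comma.snd (𝟭 ℬ) T ⋙ T) :=
      { τ₁ := structureMap S.X₁
        τ₂ := structureMap S.X₂
        τ₃ := structureMap S.X₃
        comm₁₂ := S.f.w.symm
        comm₂₃ := S.g.w.symm }
    have : Epi φ.τ₁ := h₁
    have : Epi φ.τ₃ := h₃
    have := (hS.map (Comma.fst (𝟭 ℬ) T)).epi_g
    have := (hS.map (Comma.snd (𝟭 ℬ) T ⋙ T)).epi_g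
    exact ShortComplex.epi_τ₂_of_exact_of_epi φ (hS.exact.map _)

/-- The extension closure of the image of `h` consists of the objects `φ : B ⟶ T A` such that
`φ` is an epimorphism. -/
lemma hClosure_eq : hClosure T = epiStructureMap T := by
  apply le_antisymm
  · refine extensionClosure_le _ _ ?_
    rintro X ⟨Y, ⟨e⟩⟩
    exact (epiStructureMap T).prop_of_iso e
      (inferInstanceAs (Epi (biprod.snd : Y.2 ⊞ T.obj Y.1 ⟶ _)))
  · intro X (hX : Epi (structureMap X))
    let Y : CommaCat T := { left := T.obj X.right, right := X.right, hom := 𝟙 _ }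
    have : IsIso (structureMap Y) := inferInstanceAs (IsIso (𝟙 _))
    let f : X ⟶ Y := { left := structureMap X, right := 𝟙 _ }
    have : Epi f := (epi_comma_iff f).2 ⟨hX, inferInstanceAs (Epi (𝟙 X.right))⟩
    have hz : IsZero (kernel f).right :=
      (isZero_kernel_of_mono (𝟙 X.right)).of_iso (PreservesKernel.iso (Comma.snd (𝟭 ℬ) T) f)
    exact .of_shortExact (ShortComplex.mk _ _ (kernel.condition f))
      { exact := ShortComplex.exact_kernel f }
      (.of_mem _ (essImage_of_isZero_right _ hz))
      (.of_mem _ (essImage_of_isIso_structureMap Y))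

lemma hClosure_iff (X : CommaCat T) : hClosure T X ↔ Epi (structureMap X) := by
  rw [hClosure_eq]; rfl

instance (X : HCat T) : Epi (structureMap X.obj) := (hClosure_iff T _).1 X.property

instance : (hClosure T).IsClosedUnderIsomorphisms := by rw [hClosure_eq]; infer_instance

instance : (hClosure T).ContainsZero := by rw [hClosure_eq]; infer_instance

instance : (hClosure T).IsClosedUnderExtensions := by rw [hClosure_eq]; infer_instance

lemma isExactStructure_hConflations : IsExactStructure (hConflations T) :=
  isExactStructure_inducedConflations _

variable {T}

/-- Objects with epi structure map are closed under quotients, so the condition on the cokernel is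
automatic. -/
lemma isInflation_hConflations_iff {X Y : HCat T} (i : X ⟶ Y) :
    IsInflation (hConflations T) i ↔ Mono i.hom.left ∧ Mono i.hom.right := by
  rw [← mono_comma_iff]
  refine (isInflation_inducedConflations_iff _ i).trans (and_iff_left ?_)
  rw [hClosure_iff]
  have := ((epi_comma_iff (cokernel.π i.hom)).1 inferInstance).2
  exact epi_structureMap_of_epi (cokernel.π i.hom)

lemma isDeflation_hConflations_iff {X Y : HCat T} (p : X ⟶ Y) :
    IsDeflation (hConflations T) p ↔
      (Epi p.hom.left ∧ Epi p.hom.right) ∧ Epi (structureMap (kernel p.hom)) := by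
  rw [← epi_comma_iff, ← hClosure_iff]
  exact isDeflation_inducedConflations_iff _ p

/-- Element chase: `z` in `T` of the kernel gives `(0, z)` in the pullback; a lift of it through `ψ`
is killed by `p.left`, hence lies in the kernel and maps to `z`. -/
lemma epi_structureMap_kernel {Y Z : CommaCat T} (p : Y ⟶ Z)
    (ψ : Y.left ⟶ pullback (structureMap Z) (T.map p.right)) (hψ : Epi ψ)
    (hψ₁ : ψ ≫ pullback.fst _ _ = p.left) (hψ₂ : ψ ≫ pullback.snd _ _ = structureMap Y) :
    Epi (structureMap (kernel p)) := by
  rw [epi_iff_surjective_up_to_refinements]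
  intro W z
  have hc : (kernel.ι p).right ≫ p.right = 0 := congr(($(kernel.condition p)).right)
  obtain ⟨z', hz₁, hz₂⟩ : ∃ z' : W ⟶ pullback (structureMap Z) (T.map p.right),
      z' ≫ pullback.fst _ _ = 0 ∧ z' ≫ pullback.snd _ _ = z ≫ T.map (kernel.ι p).right :=
    ⟨pullback.lift 0 (z ≫ T.map (kernel.ι p).right) (by
      rw [zero_comp, Category.assoc, ← T.map_comp, hc, T.map_zero, comp_zero]),
      pullback.lift_fst _ _ _, pullback.lift_snd _ _ _⟩
  obtain ⟨W', π, _, q, hq⟩ := surjective_up_to_refinements_of_epi ψ z'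
  have hq₁ : q ≫ p.left = 0 := by
    rw [← hψ₁, ← Category.assoc, ← hq, Category.assoc, hz₁, comp_zero]
  have hq₂ : q ≫ structureMap Y = π ≫ z ≫ T.map (kernel.ι p).right := by
    rw [← hψ₂, ← Category.assoc, ← hq, Category.assoc, hz₂]
  have hex := (ShortComplex.exact_kernel p).map (Comma.fst (𝟭 ℬ) T)
  have : Mono ((ShortComplex.mk _ _ (kernel.condition p)).map (Comma.fst (𝟭 ℬ) T)).f :=
    inferInstanceAs (Mono ((Comma.fst (𝟭 ℬ) T).map (kernel.ι p)))
  have : Mono (T.map (kernel.ι p).right) :=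
    inferInstanceAs (Mono ((Comma.snd (𝟭 ℬ) T ⋙ T).map (kernel.ι p)))
  obtain ⟨l, hl⟩ : ∃ l : W' ⟶ (kernel p).left, l ≫ (kernel.ι p).left = q :=
    ⟨_, hex.lift_f q hq₁⟩
  refine ⟨W', π, inferInstance, l, ?_⟩
  rw [← cancel_mono (T.map (kernel.ι p).right), Category.assoc, Category.assoc, ← hq₂,
    ← structureMap_naturality, reassoc_of% hl]

/-- Lift the two components independently. The defect `γ` of commutativity factors through `T` of
the kernel of `p`, whose structure map is epi; lifting `γ` along it corrects the left component. -/
lemma isRelProjective_of_projective (P : HCat T) [Projective P.obj.left]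
    [Projective P.obj.right] : IsRelProjective (hConflations T) P := fun {Y Z} p hp f => by
  obtain ⟨⟨_, _⟩, _⟩ := (isDeflation_hConflations_iff p).1 hp
  let α := Projective.factorThru f.hom.right p.hom.right
  let b := Projective.factorThru f.hom.left p.hom.left
  have hα : α ≫ p.hom.right = f.hom.right := by simp [α]
  have hb : b ≫ p.hom.left = f.hom.left := by simp [b]
  have hc : (kernel.ι p.hom).left ≫ p.hom.left = 0 := congr(($(kernel.condition p.hom)).left)
  have hex := (ShortComplex.exact_kernel p.hom).map (Comma.snd (𝟭 ℬ) T ⋙ T)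
  let γ := structureMap P.obj ≫ T.map α - b ≫ structureMap Y.obj
  have hγ : γ ≫ T.map p.hom.right = 0 := by
    simp only [γ, Preadditive.sub_comp, Category.assoc, ← T.map_comp, hα]
    rw [← structureMap_naturality p.hom, reassoc_of% hb, structureMap_naturality, sub_self]
  obtain ⟨m, hm⟩ : ∃ m : P.obj.left ⟶ T.obj (kernel p.hom).right,
      m ≫ T.map (kernel.ι p.hom).right = γ := ⟨_, hex.liftFromProjective_comp γ hγ⟩
  let k := Projective.factorThru m (structureMap (kernel p.hom))
  have hk : k ≫ structureMap (kernel p.hom) = m := by simp [k]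
  refine ⟨(hClosure T).homMk (commaHom (b + k ≫ (kernel.ι p.hom).left) α ?_), ?_⟩
  · rw [Preadditive.add_comp, Category.assoc, structureMap_naturality, reassoc_of% hk, hm]
    simp [γ]
  · ext
    · change (b + k ≫ (kernel.ι p.hom).left) ≫ p.hom.left = f.hom.left
      simp [hb, hc]
    · exact hα

/-- The left component of `Q` is a projective cover of the pullback in `epi_structureMap_kernel`.
Leaving `P` free allows the right component to be prescribed. -/
lemma exists_deflation_from_projective [EnoughProjectives 𝒜] [EnoughProjectives ℬ] (X : HCat T)
    (P : 𝒜) [Projective P] (π : P ⟶ X.obj.right) [Epi π] :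
    ∃ (Q : HCat T) (p : Q ⟶ X), Projective Q.obj.left ∧ Q.obj.right = P ∧
      IsDeflation (hConflations T) p := by
  let q := Projective.π (pullback (structureMap X.obj) (T.map π))
  have hq : Epi q := Projective.π_epi _
  let Q : CommaCat T :=
    { left := Projective.over (pullback (structureMap X.obj) (T.map π))
      right := P
      hom := q ≫ pullback.snd _ _ }
  have hs : structureMap Q = q ≫ pullback.snd _ _ := rfl
  let p : Q ⟶ X.obj := commaHom (q ≫ pullback.fst _ _) π (by
    rw [hs, Category.assoc, Category.assoc, pullback.condition])
  have hQ : hClosure T Q := (hClosure_iff T Q).2 (epi_comp q (pullback.snd _ _))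
  exact ⟨⟨Q, hQ⟩, (hClosure T).homMk p, inferInstanceAs (Projective (Projective.over _)),
    rfl, (isDeflation_hConflations_iff _).2 ⟨⟨epi_comp q (pullback.fst _ _),
      inferInstanceAs (Epi π)⟩, epi_structureMap_kernel p q hq rfl rfl⟩⟩

lemma isRelProjective_hConflations_iff [EnoughProjectives 𝒜] [EnoughProjectives ℬ] (X : HCat T) :
    IsRelProjective (hConflations T) X ↔ Projective X.obj.left ∧ Projective X.obj.right := by
  refine ⟨fun hX => ?_, fun ⟨_, _⟩ => isRelProjective_of_projective X⟩
  obtain ⟨Q, p, h₁, h₂, hp⟩ := exists_deflation_from_projective X _ (Projective.π X.obj.right)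
  have h₃ : Projective Q.obj.right := h₂ ▸ inferInstance
  obtain ⟨r⟩ := hX.exists_retract p hp
  exact ⟨(r.map ((hClosure T).ι ⋙ Comma.fst (𝟭 ℬ) T)).projective (p := h₁),
    (r.map ((hClosure T).ι ⋙ Comma.snd (𝟭 ℬ) T)).projective (p := h₃)⟩

variable (T) in
/-- The object `h(A, B)` of `⟨h(𝒜, ℬ)⟩`. -/
noncomputable def hObj (A : 𝒜) (B : ℬ) : HCat T :=
  ⟨(hFunctor T).obj (A, B), .of_mem _ ((hFunctor T).obj_mem_essImage _)⟩

/-- A morphism from `X` to `h(I, J)` amounts to a free pair `X.right ⟶ I`, `X.left ⟶ J`, the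
component in `T I` being forced; so the two can be extended separately. -/
lemma isRelInjective_hObj (I : 𝒜) (J : ℬ) [Injective I] [Injective J] :
    IsRelInjective (hConflations T) (hObj T I J) := fun {X Y} i hi f => by
  obtain ⟨_, _⟩ := (isInflation_hConflations_iff i).1 hi
  let f₁ : X.obj.left ⟶ J ⊞ T.obj I := f.hom.left
  let f₂ : X.obj.right ⟶ I := f.hom.right
  have wf : f₁ ≫ biprod.snd = structureMap X.obj ≫ T.map f₂ := f.hom.w
  let g₂ := Injective.factorThru f₂ i.hom.right
  have hg₂ : i.hom.right ≫ g₂ = f₂ := by simp [g₂]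
  let g₁ := Injective.factorThru (f₁ ≫ biprod.fst) i.hom.left
  refine ⟨(hClosure T).homMk
    (commaHom (biprod.lift g₁ (structureMap Y.obj ≫ T.map g₂)) g₂ (biprod.lift_snd _ _)), ?_⟩
  ext
  · change i.hom.left ≫ biprod.lift g₁ (structureMap Y.obj ≫ T.map g₂) = f₁
    apply biprod.hom_ext
    · simp [g₁]
    · rw [Category.assoc, biprod.lift_snd, wf, reassoc_of% (structureMap_naturality i.hom), ← T.map_comp, hg₂]
  · exact hg₂

lemma exists_inflation_hObj (X : HCat T) {I : 𝒜} {J : ℬ} (a : X.obj.right ⟶ I)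
    (b : X.obj.left ⟶ J) [Mono a] [Mono b] :
    ∃ i : X ⟶ hObj T I J, IsInflation (hConflations T) i := by
  refine ⟨(hClosure T).homMk (commaHom (biprod.lift b (structureMap X.obj ≫ T.map a)) a
    (biprod.lift_snd _ _)), (isInflation_hConflations_iff _).2 ⟨?_, by assumption⟩⟩
  exact mono_of_mono_fac (biprod.lift_fst b (structureMap X.obj ≫ T.map a))

lemma IsRelInjective.exists_retract_hObj [EnoughInjectives 𝒜] [EnoughInjectives ℬ] {X : HCat T}
    (hX : IsRelInjective (hConflations T) X) :
    Nonempty (Retract X (hObj T (Injective.under X.obj.right) (Injective.under X.obj.left))) := by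
  obtain ⟨i, hi⟩ := exists_inflation_hObj X (Injective.ι X.obj.right) (Injective.ι X.obj.left)
  exact hX.exists_retract i hi

lemma IsRelInjective.injective_right [EnoughInjectives 𝒜] [EnoughInjectives ℬ] {X : HCat T}
    (hX : IsRelInjective (hConflations T) X) : Injective X.obj.right := by
  obtain ⟨r⟩ := hX.exists_retract_hObj
  exact (r.map ((hClosure T).ι ⋙ Comma.snd (𝟭 ℬ) T)).injective
    (i := inferInstanceAs (Injective (Injective.under _)))

lemma injective_of_isRelInjective_hObj [EnoughInjectives ℬ] {A : 𝒜} {B : ℬ}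
    (h : IsRelInjective (hConflations T) (hObj T A B)) : Injective B := by
  let i : hObj T A B ⟶ hObj T A (Injective.under B) :=
    (hClosure T).homMk ((hFunctor T).map (𝟙 A, Injective.ι B))
  have hi : IsInflation (hConflations T) i := (isInflation_hConflations_iff i).2
    ⟨inferInstanceAs (Mono (biprod.map (Injective.ι B) (T.map (𝟙 A)))),
      inferInstanceAs (Mono (𝟙 A))⟩
  obtain ⟨s, hs⟩ := h i hi (𝟙 _)
  let s₁ : Injective.under B ⊞ T.obj A ⟶ B ⊞ T.obj A := s.hom.left
  have hs₁ : biprod.map (Injective.ι B) (T.map (𝟙 A)) ≫ s₁ = 𝟙 _ := congr(($hs).hom.left)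
  let r : Retract B (Injective.under B) :=
    { i := Injective.ι B
      r := biprod.inl ≫ s₁ ≫ biprod.fst
      retract := by
        have := congr(biprod.inl ≫ $hs₁ ≫ biprod.fst)
        simpa using this }
  exact r.injective

end HClosure

/-! ### Transfer of the Frobenius property. -/

section Frobenius

open ZeroObject

variable {𝒜 : Type u₁} [Category.{v₁} 𝒜] [Abelian 𝒜] [EnoughProjectives 𝒜]
  {ℬ : Type u₂} [Category.{v₂} ℬ] [Abelian ℬ] [EnoughProjectives ℬ]
  {T : 𝒜 ⥤ ℬ} [T.Additive] [PreservesFiniteLimits T] [PreservesFiniteColimits T]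

lemma projective_of_isRelProjective_hObj {A : 𝒜} {B : ℬ}
    (h : IsRelProjective (hConflations T) (hObj T A B)) :
    Projective A ∧ Projective B ∧ Projective (T.obj A) := by
  obtain ⟨h₁, h₂⟩ := (isRelProjective_hConflations_iff _).1 h
  have : Projective (B ⊞ T.obj A) := h₁
  exact ⟨h₂, Retract.projective (⟨biprod.inl, biprod.fst, by simp⟩ : Retract B (B ⊞ T.obj A)),
    Retract.projective (⟨biprod.inr, biprod.snd, by simp⟩ : Retract (T.obj A) (B ⊞ T.obj A))⟩

/-- A splitting of the structure morphism of `X` makes `X` a retract of `h(A, B)`, where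
`X` is `B ⟶ T A`. -/
noncomputable def retractHObj (X : HCat T) (s : T.obj X.obj.right ⟶ X.obj.left)
    (hs : s ≫ structureMap X.obj = 𝟙 _) : Retract X (hObj T X.obj.right X.obj.left) where
  i := (hClosure T).homMk (commaHom (biprod.lift (𝟙 _) (structureMap X.obj)) (𝟙 _)
    (by
      change biprod.lift (𝟙 X.obj.left) (structureMap X.obj) ≫ biprod.snd =
        structureMap X.obj ≫ T.map (𝟙 X.obj.right)
      simp))
  -- The endomorphism `𝟙 - φ ≫ s` is the projection onto `ker φ` given by the splitting, so it
  -- vanishes after `φ`.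
  r := (hClosure T).homMk (commaHom (biprod.desc (𝟙 _ - structureMap X.obj ≫ s) s) (𝟙 _) (by
    change biprod.desc (𝟙 _ - structureMap X.obj ≫ s) s ≫ structureMap X.obj =
      (biprod.snd : X.obj.left ⊞ T.obj X.obj.right ⟶ _) ≫ T.map (𝟙 X.obj.right)
    apply biprod.hom_ext' <;> simp [hs]))
  retract := by
    ext
    · change biprod.lift (𝟙 _) (structureMap X.obj) ≫
        biprod.desc (𝟙 _ - structureMap X.obj ≫ s) s = 𝟙 _
      simp
    · exact Category.comp_id _

lemma IsFrobenius.projective_of_injective_left (h : IsFrobenius (hConflations T)) (I : 𝒜)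
    [Injective I] : Projective I ∧ Projective (T.obj I) :=
  have := projective_of_isRelProjective_hObj
    ((h.projective_iff_injective _).2 (isRelInjective_hObj I 0))
  ⟨this.1, this.2.2⟩

lemma IsFrobenius.projective_of_injective_right (h : IsFrobenius (hConflations T)) (J : ℬ)
    [Injective J] : Projective J :=
  (projective_of_isRelProjective_hObj
    ((h.projective_iff_injective _).2 (isRelInjective_hObj 0 J))).2.1

variable [EnoughInjectives 𝒜] [EnoughInjectives ℬ]

lemma isFrobenius_hConflations (hA : ∀ X : 𝒜, Projective X ↔ Injective X)
    (hB : ∀ X : ℬ, Projective X ↔ Injective X) [T.PreservesInjectiveObjects] :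
    IsFrobenius (hConflations T) where
  isExactStructure := isExactStructure_hConflations T
  enoughProjectives X := by
    obtain ⟨Q, p, h₁, h₂, hp⟩ := exists_deflation_from_projective X _ (Projective.π X.obj.right)
    exact ⟨Q, p, (isRelProjective_hConflations_iff Q).2 ⟨h₁, h₂ ▸ inferInstance⟩, hp⟩
  enoughInjectives X := by
    obtain ⟨i, hi⟩ := exists_inflation_hObj X (Injective.ι X.obj.right) (Injective.ι X.obj.left)
    exact ⟨_, i, isRelInjective_hObj _ _, hi⟩
  projective_iff_injective X := by
    rw [isRelProjective_hConflations_iff]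
    constructor
    · rintro ⟨h₁, h₂⟩
      have := (hA _).1 h₂
      have := (hB _).1 h₁
      have : Projective (T.obj X.obj.right) := (hB _).2 inferInstance
      intro Y Z
      exact IsRelInjective.of_retract (isRelInjective_hObj _ _)
        (retractHObj X (Projective.factorThru (𝟙 _) (structureMap X.obj)) (by simp))
    · intro h
      refine ⟨(hB _).2 ?_, (hA _).2 h.injective_right⟩
      obtain ⟨r⟩ := h.exists_retract_hObj
      exact (r.map ((hClosure T).ι ⋙ Comma.fst (𝟭 ℬ) T)).injective
        (i := inferInstanceAs (Injective (_ ⊞ T.obj (Injective.under X.obj.right))))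

/-- `h(P, 0)` itself need not be visibly projective, as its left component involves `T P`; it is
replaced by a relative projective with the same right component. -/
lemma IsFrobenius.injective_of_projective_left (h : IsFrobenius (hConflations T)) (P : 𝒜)
    [Projective P] : Injective P := by
  let π : P ⟶ (hObj T P 0).obj.right := 𝟙 P
  have : Epi π := inferInstanceAs (Epi (𝟙 P))
  obtain ⟨Q, p, h₁, h₂, -⟩ := exists_deflation_from_projective (hObj T P 0) P π
  have h₃ : Projective Q.obj.right := h₂ ▸ inferInstance
  have := IsRelInjective.injective_right ((h.projective_iff_injective Q).1
    ((isRelProjective_hConflations_iff Q).2 ⟨h₁, h₃⟩))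
  exact h₂ ▸ this

omit [EnoughInjectives 𝒜] in
lemma IsFrobenius.injective_of_projective_right (h : IsFrobenius (hConflations T)) (P : ℬ)
    [Projective P] : Injective P := by
  refine injective_of_isRelInjective_hObj (T := T) (A := 0) ((h.projective_iff_injective _).1 ?_)
  have hz : IsZero (T.obj (0 : 𝒜)) := T.map_isZero (isZero_zero _)
  have h₁ : Projective (P ⊞ T.obj (0 : 𝒜)) := .of_iso (isoBiprodZero hz) inferInstance
  have h₂ : Projective (0 : 𝒜) := inferInstance
  intro Y Z
  exact (isRelProjective_hConflations_iff (hObj T 0 P)).2 ⟨h₁, h₂⟩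

end Frobenius

end FrobeniusComma

theorem mainTheorem9
    {𝒜 : Type u₁} [Category.{v₁} 𝒜] [Abelian 𝒜] [EnoughProjectives 𝒜] [EnoughInjectives 𝒜]
    {ℬ : Type u₂} [Category.{v₂} ℬ] [Abelian ℬ] [EnoughProjectives ℬ] [EnoughInjectives ℬ]
    (T : 𝒜 ⥤ ℬ) [T.Additive] [PreservesFiniteLimits T] [PreservesFiniteColimits T] :
    FrobeniusComma.IsExactStructure (FrobeniusComma.hConflations T) ∧
      (FrobeniusComma.IsFrobenius (FrobeniusComma.hConflations T) ↔
        FrobeniusComma.IsFrobenius (FrobeniusComma.shortExactSequences 𝒜) ∧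
        FrobeniusComma.IsFrobenius (FrobeniusComma.shortExactSequences ℬ) ∧
        T.PreservesInjectiveObjects) := by
  refine ⟨FrobeniusComma.isExactStructure_hConflations T, ?_⟩
  rw [FrobeniusComma.isFrobenius_shortExactSequences_iff,
    FrobeniusComma.isFrobenius_shortExactSequences_iff]
  constructor
  · intro h
    refine ⟨fun X => ⟨fun _ => h.injective_of_projective_left X,
        fun _ => (h.projective_of_injective_left X).1⟩,
      fun X => ⟨fun _ => h.injective_of_projective_right X,
        fun _ => h.projective_of_injective_right X⟩, ⟨fun {X} _ => ?_⟩⟩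
    -- `T X` is a summand of the left component of the relative projective `h(X, 0)`, hence
    -- projective, and projectives of `ℬ` are injective.
    have := (h.projective_of_injective_left X).2
    exact h.injective_of_projective_right (T.obj X)
  · rintro ⟨hA, hB, _⟩
    exact FrobeniusComma.isFrobenius_hConflations hA hB
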